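/- All graphs are finite, undirected and simple. Let $\alpha(G)$ be the independence number of $G$, and let $G\boxtimes W$ be the strong product: its vertex set is $V(G)\times V(W)$, and two distinct pairs are adjacent iff in each coordinate they are equal or adjacent. The relative fractional independence number of $G$ with respect to $H$ is $$\alpha^*(G|H)=\sup_W \frac{\alpha(G\boxtimes W)}{\alpha(H\boxtimes W)}\in[0,\infty],$$ where $W$ runs over all finite graphs with at least one vertex (if $V(H)=\emptyset$, so that the denominators vanish, we read $x/0=\infty$ for $x>0$ and $0/0=0$). Let $\mathrm{Expand}(H)$ be the set of all graphs that can be obtained, up to isomorphism, from $H$ by a finite (possibly empty) sequence of the following operations: (I) remove a vertex; (II) replace a vertex $v$ by a clique of arbitrary size $m\ge 1$, all of whose vertices are joined to all neighbours of $v$; (III) add a new edge between two distinct non-adjacent vertices. A graph is perfect if each of its induced subgraphs has chromatic number equal to its clique number. Let $H$ be an arbitrary graph. In each of the following two cases, $\alpha^*(G|H)\le 1$ implies $G\in \mathrm{Expand}(H)$: (i) $G=\mathrm{Cay}(\mathbb{Z}_n,\pm1,\pm2,\dots,\pm k)$, the graph on $\mathbb{Z}/n\mathbb{Z}$ in which two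 distinct elements $a,b$ are adjacent iff $a-b\in\{\pm1,\dots,\pm k\}$, where $n\ge 1$, $k\ge 0$ are integers such that $n=c(k+1)$ or $n=c(k+1)+1$ for some integer $c\ge 0$ (the case $k=1$, $n\ge 3$ gives all cycles); (ii) $G$ is a perfect graph. -/

import Mathlib

open scoped ENNReal

noncomputable section

namespace SimpleGraph

universe u v w

/-- The strong product `G ⊠ W`: distinct pairs are adjacent iff in each coordinate they are
equal or adjacent. -/
def strongProd {V : Type u} {W : Type v} (G : SimpleGraph V) (K : SimpleGraph W) :
    SimpleGraph (V × W) where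
  Adj x y := (x.1 = y.1 ∧ K.Adj x.2 y.2) ∨ (G.Adj x.1 y.1 ∧ x.2 = y.2) ∨
    (G.Adj x.1 y.1 ∧ K.Adj x.2 y.2)
  symm := ⟨by
    rintro x y (⟨h, h'⟩ | ⟨h, h'⟩ | ⟨h, h'⟩)
    · exact Or.inl ⟨h.symm, h'.symm⟩
    · exact Or.inr (Or.inl ⟨h.symm, h'.symm⟩)
    · exact Or.inr (Or.inr ⟨h.symm, h'.symm⟩)⟩
  loopless := ⟨by
    rintro x (⟨_, h⟩ | ⟨h, _⟩ | ⟨h, _⟩)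
    · exact K.irrefl h
    · exact G.irrefl h
    · exact G.irrefl h⟩

/-- The relative fractional independence number `α*(G|H) = sup_W α(G ⊠ W) / α(H ⊠ W)`. The
supremum is over all finite graphs `W` with at least one vertex, where up to isomorphism the
vertex set of `W` is `{0, …, m - 1}`. It is taken in `[0, ∞]`; the denominator vanishes only if `H`
has no vertices. -/
def relFracIndepNum {V : Type u} {U : Type v} (G : SimpleGraph V) (H : SimpleGraph U) : ℝ≥0∞ :=
  ⨆ (m : ℕ) (_ : 1 ≤ m) (W : SimpleGraph (Fin m)),
    ((G.strongProd W).indepNum : ℝ≥0∞) / ((H.strongProd W).indepNum : ℝ≥0∞)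

/-- The graph obtained from `G` by removing the vertex `a`. -/
def removeVertex {V : Type u} (G : SimpleGraph V) (a : V) : SimpleGraph {x : V // x ≠ a} :=
  G.induce {x : V | x ≠ a}

/-- The graph obtained from `G` by replacing the vertex `a` by a clique with `k` vertices, each of
which is joined to all neighbours of `a`. -/
def replaceByClique {V : Type u} (G : SimpleGraph V) (a : V) (k : ℕ) :
    SimpleGraph ({x : V // x ≠ a} ⊕ Fin k) where
  Adj
    | Sum.inl x, Sum.inl y => G.Adj x y
    | Sum.inl x, Sum.inr _ => G.Adj x a
    | Sum.inr _, Sum.inl y => G.Adj a y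
    | Sum.inr i, Sum.inr j => i ≠ j
  symm := ⟨by
    rintro (x | i) (y | j) h
    · exact G.adj_symm h
    · exact G.adj_symm h
    · exact G.adj_symm h
    · exact Ne.symm h⟩
  loopless := ⟨by
    rintro (x | i) h
    · exact G.irrefl h
    · exact h rfl⟩

/-- `G'` arises, up to isomorphism, from `G` by a single operation: removing a vertex, replacing a
vertex by a clique, or adding a new edge. -/
inductive ExpandStep {V : Type u} {V' : Type v} (G : SimpleGraph V) (G' : SimpleGraph V') : Prop
  | remove (a : V) (e : G' ≃g G.removeVertex a) : ExpandStep G G'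
  | replace (a : V) (k : ℕ) (hk : 1 ≤ k) (e : G' ≃g G.replaceByClique a k) : ExpandStep G G'
  | addEdge (a b : V) (hab : a ≠ b) (hn : ¬ G.Adj a b) (e : G' ≃g G ⊔ edge a b) : ExpandStep G G'

/-- `InExpand H G` says that `G ∈ Expand(H)`: up to isomorphism, `G` is obtained from `H` by a
finite (possibly empty) sequence of the three operations. -/
inductive InExpand {U : Type u} (H : SimpleGraph U) : ∀ {V : Type v}, SimpleGraph V → Prop
  | start {V : Type v} {G : SimpleGraph V} (e : G ≃g H) : InExpand H G
  | step {V V' : Type v} {G : SimpleGraph V} {G' : SimpleGraph V'} (h : InExpand H G)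
      (hs : ExpandStep G G') : InExpand H G'

/-- A (finite) graph is perfect if every induced subgraph has chromatic number equal to its clique
number. -/
def IsPerfect {V : Type u} (G : SimpleGraph V) : Prop :=
  ∀ s : Set V, (G.induce s).chromaticNumber = ((G.induce s).cliqueNum : ℕ∞)

/-- The Cayley graph `Cay(ℤ/n, ±1, …, ±k)`: distinct `a`, `b` are adjacent iff
`a - b ∈ {±1, …, ±k}`. -/
def cyclicCayley (n k : ℕ) : SimpleGraph (ZMod n) :=
  circulantGraph {x : ZMod n | ∃ j : ℕ, 1 ≤ j ∧ j ≤ k ∧ (x = (j : ZMod n) ∨ x = -(j : ZMod n))}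

end SimpleGraph

end

namespace SimpleGraph

universe u v w

/-! ### Expansions and homomorphisms of complements -/

/-! A homomorphism `Gᶜ →g Hᶜ` yields `G ∈ Expand(H)`: deletion makes it surjective, cloning makes it
injective, and adding edges does the rest (`InExpand.of_compl_hom`). So if `Gᶜ` has a colouring with
at most `α(H)` colours, mapping the colours into a maximum independent set of `H` suffices. Taking
`W` to be a point gives `α(G) ≤ α(H)`. Perfect graphs then follow from the weak perfect graph
theorem, and `n = c(k+1)` from cutting the cycle into `c` cliques. For `n = c(k+1)+1` the blocks may
need `c+1` colours. If `α(H) ≤ c`, take `W = Gᶜ`: the diagonal of `G ⊠ Gᶜ` is independent, so `H ⊠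
Gᶜ` has an independent set of at least `n` points. Counting over cliques of `Gᶜ` forces all its
fibres over `Gᶜ` to have the same positive size, and choosing a point in each fibre gives the
homomorphism. -/

theorem InExpand.congr {U : Type u} {H : SimpleGraph U} {V V' : Type v} {G : SimpleGraph V}
    {G' : SimpleGraph V'} (h : InExpand H G) (e : G' ≃g G) : InExpand H G' := by
  cases h with
  | start e' => exact .start (e.trans e')
  | step h hs =>
    refine .step h ?_
    cases hs with
    | remove a e' => exact .remove a (e.trans e')
    | replace a k hk e' => exact .replace a k hk (e.trans e')
    | addEdge a b hab hn e' => exact .addEdge a b hab hn (e.trans e')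

theorem InExpand.of_le {U : Type u} {H : SimpleGraph U} {V : Type v} [Finite V]
    {G K : SimpleGraph V} (hK : InExpand H K) (hle : K ≤ G) : InExpand H G := by
  induction K using WellFoundedGT.induction with
  | ind K ih =>
    by_cases h : ∃ a b, G.Adj a b ∧ ¬ K.Adj a b
    · obtain ⟨a, b, hG, hn⟩ := h
      refine ih (K ⊔ edge a b) ?_ (.step hK (.addEdge a b hG.ne hn (Iso.refl))) ?_
      · refine lt_of_le_of_ne le_sup_left fun heq => hn ?_
        rw [heq]
        exact Or.inr ((edge_adj a b a b).2 ⟨Or.inl ⟨rfl, rfl⟩, hG.ne⟩)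
      · refine sup_le hle ((edge_le_iff _).2 (Or.inr hG))
    · push Not at h
      have : K = G := le_antisymm hle fun a b hab => h a b hab
      exact this ▸ hK

/-- If two vertices share an image, cloning that image separates them. Each cloning lowers the
excess of `|V|` over `|W|`, which `n` bounds. -/
theorem InExpand.of_compl_hom_surjective {U : Type u} {H : SimpleGraph U} {V : Type v} [Finite V]
    {G : SimpleGraph V} (n : ℕ) : ∀ {W : Type v} [Finite W] {K : SimpleGraph W} (f : Gᶜ →g Kᶜ),
      Nat.card V ≤ Nat.card W + n → Function.Surjective f → InExpand H K → InExpand H G := by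
  induction n with
  | zero =>
    intro W _ K f hn hf hK
    have hb : Function.Bijective f :=
      hf.bijective_of_nat_card_le (by simpa using hn)
    refine (hK.congr (Iso.comap (Equiv.ofBijective f hb) K)).of_le fun x y hxy => ?_
    by_contra hG
    have := f.map_rel (show Gᶜ.Adj x y from ⟨hxy.ne, hG⟩)
    exact this.2 hxy
  | succ n ih =>
    intro W _ K f hn hf hK
    classical
    by_cases hi : Function.Injective f
    · exact ih f (by have := Nat.card_le_card_of_injective f hi; omega) hf hK
    · simp only [Function.Injective] at hi
      push Not at hi
      obtain ⟨x₀, x₁, he, hne⟩ := hi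
      have hK' : InExpand H (K.replaceByClique (f x₀) 2) :=
        .step hK (.replace (f x₀) 2 one_le_two Iso.refl)
      -- `x₀` alone takes the first clone; the rest of its fibre takes the second.
      let g : V → {x : W // x ≠ f x₀} ⊕ Fin 2 := fun x =>
        if h : f x = f x₀ then Sum.inr (if x = x₀ then 0 else 1) else Sum.inl ⟨f x, h⟩
      let φ : Gᶜ →g (K.replaceByClique (f x₀) 2)ᶜ := ⟨g, ?_⟩
      · refine ih φ ?_ ?_ hK'
        · have : Nat.card W = Nat.card {x : W // x ≠ f x₀} + 1 := by
            have := Fintype.ofFinite W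
            rw [Nat.card_eq_fintype_card, Nat.card_eq_fintype_card,
              Fintype.card_subtype_compl, Fintype.card_subtype_eq]
            have : 0 < Fintype.card W := Fintype.card_pos_iff.2 ⟨f x₀⟩
            omega
          rw [Nat.card_sum, Nat.card_fin]
          omega
        · rintro (⟨w, hw⟩ | i)
          · obtain ⟨x, rfl⟩ := hf w
            exact ⟨x, dif_neg hw⟩
          · fin_cases i
            · exact ⟨x₀, by simp [φ, g]⟩
            · exact ⟨x₁, by simp [φ, g, he, hne.symm]⟩
      · intro x y hxy
        have h := f.map_rel hxy
        have hne' : g x ≠ g y ∧ ¬ (K.replaceByClique (f x₀) 2).Adj (g x) (g y) := by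
          by_cases hx : f x = f x₀ <;> by_cases hy : f y = f x₀
          · exact absurd (hx.trans hy.symm) h.1
          · have hgx : g x = Sum.inr _ := dif_pos hx
            have hgy : g y = Sum.inl _ := dif_neg hy
            rw [hgx, hgy]
            exact ⟨Sum.inr_ne_inl, fun hK => h.2 (hx ▸ hK)⟩
          · have hgx : g x = Sum.inl _ := dif_neg hx
            have hgy : g y = Sum.inr _ := dif_pos hy
            rw [hgx, hgy]
            exact ⟨Sum.inl_ne_inr, fun hK => h.2 (hy ▸ hK)⟩
          · have hgx : g x = Sum.inl _ := dif_neg hx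
            have hgy : g y = Sum.inl _ := dif_neg hy
            rw [hgx, hgy]
            exact ⟨fun he => h.1 (congrArg Subtype.val (Sum.inl_injective he)), h.2⟩
        exact hne'

theorem InExpand.of_compl_hom_aux {U : Type u} {H : SimpleGraph U} {V : Type v} [Finite V]
    {G : SimpleGraph V} (n : ℕ) : ∀ {W : Type v} [Finite W] {K : SimpleGraph W} (_ : Gᶜ →g Kᶜ),
      Nat.card W = n → InExpand H K → InExpand H G := by
  induction n with
  | zero =>
    intro W _ K f hn hK
    have : IsEmpty W := (Nat.card_eq_zero.1 hn).resolve_right (not_infinite_iff_finite.2 ‹_›)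
    have : IsEmpty V := f.toFun.isEmpty
    exact InExpand.of_compl_hom_surjective 0 f (by simp) (fun w => isEmptyElim w) hK
  | succ n ih =>
    intro W _ K f hn hK
    by_cases hf : Function.Surjective f
    · exact InExpand.of_compl_hom_surjective (Nat.card V) f (by omega) hf hK
    · simp only [Function.Surjective] at hf
      push Not at hf
      obtain ⟨a, ha⟩ := hf
      refine ih (W := {x : W // x ≠ a}) (K := K.removeVertex a)
        ⟨fun x => ⟨f x, ha x⟩, fun {x y} h => ?_⟩ ?_ (.step hK (.remove a Iso.refl))
      · have := f.map_rel h
        exact ⟨fun he => this.1 (congrArg Subtype.val he), this.2⟩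
      · classical
        have := Fintype.ofFinite W
        rw [Nat.card_eq_fintype_card] at hn
        rw [Nat.card_eq_fintype_card, Fintype.card_subtype_compl, Fintype.card_subtype_eq]
        omega

/-- A homomorphism between the complements exhibits a graph as an expansion. -/
theorem InExpand.of_compl_hom {U : Type u} [Finite U] {H : SimpleGraph U} {V : Type v} [Finite V]
    {G : SimpleGraph V} (f : Gᶜ →g Hᶜ) : InExpand H G := by
  -- Expansion steps stay in one universe, so `H` is first copied into that of `V`.
  let e : ULift.{v} (Fin (Nat.card U)) ≃ U := Equiv.ulift.trans (Finite.equivFin U).symm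
  refine InExpand.of_compl_hom_aux (K := H.comap e) _ ⟨fun x => e.symm (f x), fun {x y} h => ?_⟩ rfl
    (.start (Iso.comap e H))
  have := f.map_rel h
  exact ⟨fun he => this.1 (e.symm.injective he), by simpa using this.2⟩

/-- A colouring of the complement by at most `α(H)` colours exhibits a graph as an
expansion of `H`. -/
theorem InExpand.of_coloring {U : Type u} [Finite U] {H : SimpleGraph U} {V : Type v} [Finite V]
    {G : SimpleGraph V} {t : Finset U} (ht : H.IsIndepSet t) (c : V → ℕ) (hc : ∀ x, c x < t.card)
    (hadj : ∀ x y, Gᶜ.Adj x y → c x ≠ c y) : InExpand H G := by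
  refine InExpand.of_compl_hom ⟨fun x => t.equivFin.symm ⟨c x, hc x⟩, fun {x y} h => ?_⟩
  have hne : (t.equivFin.symm ⟨c x, hc x⟩ : U) ≠ t.equivFin.symm ⟨c y, hc y⟩ := fun he =>
    hadj x y h (by simpa using he)
  exact ⟨hne, ht (Subtype.coe_prop _) (Subtype.coe_prop _) hne⟩

/-! ### Consequences of `α*(G|H) ≤ 1` -/

theorem indepNum_strongProd_le {V : Type u} {U : Type v} {G : SimpleGraph V} {H : SimpleGraph U}
    (h : relFracIndepNum G H ≤ 1) {m : ℕ} (hm : 1 ≤ m) (W : SimpleGraph (Fin m)) :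
    (G.strongProd W).indepNum ≤ (H.strongProd W).indepNum := by
  have h1 : ((G.strongProd W).indepNum : ℝ≥0∞) / ((H.strongProd W).indepNum : ℝ≥0∞) ≤ 1 := by
    refine le_trans ?_ h
    rw [relFracIndepNum]
    exact le_iSup₂_of_le m hm (le_iSup (fun W : SimpleGraph (Fin m) =>
      ((G.strongProd W).indepNum : ℝ≥0∞) / ((H.strongProd W).indepNum : ℝ≥0∞)) W)
  -- The bound `1` is neither `0` nor `∞`, so a zero denominator needs no separate case.
  rw [ENNReal.div_le_iff_le_mul (by simp) (by simp), one_mul] at h1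
  exact_mod_cast h1

theorem exists_isIndepSet_strongProd {V : Type u} {U : Type v} [Finite V]
    {G : SimpleGraph V} {H : SimpleGraph U} (h : relFracIndepNum G H ≤ 1) {W : Type w} [Finite W]
    [Nonempty W] (K : SimpleGraph W) {s : Finset (V × W)} (hs : (G.strongProd K).IsIndepSet s) :
    ∃ t : Finset (U × W), (H.strongProd K).IsIndepSet t ∧ s.card ≤ t.card := by
  let e := Finite.equivFin W
  have hle := indepNum_strongProd_le h (Nat.card_pos (α := W)) (K.comap e.symm)
  have hs' : (G.strongProd (K.comap e.symm)).IsIndepSet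
      (s.map ((Equiv.refl V).prodCongr e).toEmbedding : Finset _) := by
    intro x hx y hy hne
    simp only [Finset.coe_map, Set.mem_image] at hx hy
    obtain ⟨x, hx, rfl⟩ := hx
    obtain ⟨y, hy, rfl⟩ := hy
    have := hs hx hy (fun h => hne (h ▸ rfl))
    simpa [strongProd] using this
  obtain ⟨t, ht, hc⟩ := (H.strongProd (K.comap e.symm)).exists_isNIndepSet_indepNum
  refine ⟨t.map ((Equiv.refl U).prodCongr e.symm).toEmbedding, ?_, ?_⟩
  · intro x hx y hy hne
    simp only [Finset.coe_map, Set.mem_image] at hx hy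
    obtain ⟨x, hx, rfl⟩ := hx
    obtain ⟨y, hy, rfl⟩ := hy
    have := ht hx hy (fun h => hne (h ▸ rfl))
    simpa [strongProd] using this
  · have := hs'.card_le_indepNum
    rw [Finset.card_map] at *
    omega

theorem exists_isIndepSet_card_le {V : Type u} {U : Type v} [Finite V]
    {G : SimpleGraph V} {H : SimpleGraph U} (h : relFracIndepNum G H ≤ 1)
    {s : Finset V} (hs : G.IsIndepSet s) :
    ∃ t : Finset U, H.IsIndepSet t ∧ s.card ≤ t.card := by
  obtain ⟨t, ht, hc⟩ := exists_isIndepSet_strongProd h (⊥ : SimpleGraph Unit)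
    (s := s.map (Equiv.prodUnique V Unit).symm.toEmbedding) (by
      intro x hx y hy hne
      simp only [Finset.coe_map, Set.mem_image] at hx hy
      obtain ⟨x, hx, rfl⟩ := hx
      obtain ⟨y, hy, rfl⟩ := hy
      have := hs hx hy (fun h => hne (h ▸ rfl))
      simpa [strongProd] using this)
  refine ⟨t.map (Equiv.prodUnique U Unit).toEmbedding, ?_, by simpa using hc⟩
  intro x hx y hy hne
  simp only [Finset.coe_map, Set.mem_image] at hx hy
  obtain ⟨x, hx, rfl⟩ := hx
  obtain ⟨y, hy, rfl⟩ := hy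
  have := ht hx hy (fun h => hne (h ▸ rfl))
  simp only [strongProd, bot_adj] at this
  simp at this ⊢
  exact this

/-! ### The weak perfect graph theorem -/

/-- Gasparian's argument: if every set of vertices `s` contains an independent set `A` and a clique
`Q` with `|s| ≤ |A| |Q|`, then every set of vertices can be properly coloured by as many colours as
some clique inside it has vertices. -/
theorem exists_coloring_of_card_le_mul {V : Type u} (G : SimpleGraph V)
    (h : ∀ s : Finset V, ∃ A ⊆ s, ∃ Q ⊆ s, G.IsIndepSet A ∧ G.IsClique Q ∧
      s.card ≤ A.card * Q.card) (s : Finset V) :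
    ∃ Q ⊆ s, G.IsClique Q ∧ ∃ c : V → ℕ, (∀ v ∈ s, c v < Q.card) ∧
      ∀ x ∈ s, ∀ y ∈ s, G.Adj x y → c x ≠ c y := by
  classical
  induction s using Finset.strongInduction with
  | H s ih =>
  by_contra hbad
  obtain ⟨A, hAs, Q₁, hQ₁s, hA, hQ₁, hcard⟩ := h s
  obtain ⟨Q₀, hQ₀mem, hmax⟩ := Finset.exists_max_image
    (s.powerset.filter fun Q : Finset V => G.IsClique Q) Finset.card
    ⟨Q₁, by simp [hQ₁s, hQ₁]⟩
  simp only [Finset.mem_filter, Finset.mem_powerset] at hQ₀mem hmax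
  obtain ⟨hQ₀s, hQ₀⟩ := hQ₀mem
  set ω := Q₀.card with hω
  have hAω : s.card ≤ A.card * ω :=
    hcard.trans (Nat.mul_le_mul_left _ (hmax Q₁ ⟨hQ₁s, hQ₁⟩))
  have hs : s.Nonempty := by
    by_contra hs
    rw [Finset.not_nonempty_iff_eq_empty] at hs
    subst hs
    exact hbad ⟨∅, subset_rfl, by simp, fun _ => 0, by simp, by simp⟩
  -- If deleting `S` lowered the clique number, one extra colour for `S` would colour `s` with `ω`
  -- colours.
  have hcolor : ∀ S ⊆ s, S.Nonempty → G.IsIndepSet S → ∃ Q ⊆ s \ S, G.IsClique Q ∧ Q.card = ω ∧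
      ∃ c : V → ℕ, (∀ v ∈ s \ S, c v < ω) ∧ ∀ x ∈ s \ S, ∀ y ∈ s \ S, G.Adj x y → c x ≠ c y := by
    intro S hSs hS hSi
    obtain ⟨Q, hQs, hQ, c, hc, hadj⟩ := ih (s \ S) (Finset.sdiff_ssubset hSs hS)
    rcases (hmax Q ⟨hQs.trans Finset.sdiff_subset, hQ⟩).eq_or_lt with heq | hlt
    · exact ⟨Q, hQs, hQ, heq, c, heq ▸ hc, hadj⟩
    · refine absurd ⟨Q₀, hQ₀s, hQ₀, fun v => if v ∈ S then Q.card else c v, ?_, ?_⟩ hbad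
      · intro v hv
        by_cases hvS : v ∈ S
        · simpa [hvS] using hlt
        · simpa [hvS] using (hc v (Finset.mem_sdiff.2 ⟨hv, hvS⟩)).trans hlt
      · intro x hx y hy hxy
        by_cases hxS : x ∈ S <;> by_cases hyS : y ∈ S
        · exact absurd hxy (hSi hxS hyS hxy.ne)
        · simpa [hxS, hyS] using (hc y (Finset.mem_sdiff.2 ⟨hy, hyS⟩)).ne'
        · simpa [hxS, hyS] using (hc x (Finset.mem_sdiff.2 ⟨hx, hxS⟩)).ne
        · simpa [hxS, hyS] using
            hadj x (Finset.mem_sdiff.2 ⟨hx, hxS⟩) y (Finset.mem_sdiff.2 ⟨hy, hyS⟩) hxy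
  have hdisj : ∀ S ⊆ s, G.IsIndepSet S → ∃ Q ⊆ s \ S, G.IsClique Q ∧ Q.card = ω := by
    intro S hSs hSi
    rcases S.eq_empty_or_nonempty with rfl | hS
    · exact ⟨Q₀, by simpa using hQ₀s, hQ₀, rfl⟩
    · obtain ⟨Q, h1, h2, h3, -⟩ := hcolor S hSs hS hSi
      exact ⟨Q, h1, h2, h3⟩
  have hcolor' : ∀ a : A, ∃ c : V → ℕ, (∀ v ∈ s.erase a, c v < ω) ∧
      ∀ x ∈ s.erase a, ∀ y ∈ s.erase a, G.Adj x y → c x ≠ c y := by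
    intro a
    obtain ⟨-, -, -, -, hc⟩ := hcolor {a.1} (by simpa using hAs a.2) (by simp) (by simp)
    simpa only [Finset.sdiff_singleton_eq_erase] using hc
  choose c hc hadj using hcolor'
  -- These `|A|ω + 1` independent sets are `A` and, for each `a ∈ A`, the colour classes of `s \
  -- {a}`.
  let S : Option (A × Fin ω) → Finset V
    | none => A
    | some (a, i) => (s.erase a).filter fun v => c a v = i
  have hSs : ∀ i, S i ⊆ s := by
    rintro (_ | ⟨a, i⟩)
    · exact hAs
    · exact (Finset.filter_subset _ _).trans (Finset.erase_subset _ _)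
  have hSi : ∀ i, G.IsIndepSet (S i) := by
    rintro (_ | ⟨a, i⟩)
    · exact hA
    · intro x hx y hy _ hxy
      simp only [S, Finset.coe_filter, Set.mem_ofPred_eq] at hx hy
      exact hadj a x hx.1 y hy.1 hxy (hx.2.trans hy.2.symm)
  choose Q hQs hQ hQc using fun i => hdisj (S i) (hSs i) (hSi i)
  have hle : ∀ i j, (S i ∩ Q j).card ≤ 1 := by
    intro i j
    refine Finset.card_le_one.2 fun x hx y hy => ?_
    rw [Finset.mem_inter] at hx hy
    by_contra hne
    exact hSi i hx.1 hy.1 hne (hQ j hx.2 hy.2 hne)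
  -- Each `a ∈ A` contributes `ω`: the classes of `s \ {a}` cover `Q j` except possibly `a`, and `A`
  -- itself counts `a` if it was missed.
  have hsum : ∀ j, ∑ i, (S i ∩ Q j).card = A.card * ω := by
    intro j
    have hfib : ∀ a : A, ∑ i : Fin ω, (S (some (a, i)) ∩ Q j).card = ((Q j).erase a).card := by
      intro a
      rw [Finset.card_eq_sum_card_fiberwise (f := c a) (t := Finset.range ω), Finset.sum_range]
      · refine Finset.sum_congr rfl fun i _ => congrArg Finset.card ?_
        ext v
        have := @hQs j v
        simp only [S, Finset.mem_inter, Finset.mem_filter, Finset.mem_erase, Finset.mem_sdiff]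
          at this ⊢
        tauto
      · intro v hv
        have hv' := Finset.mem_erase.1 (Finset.mem_coe.1 hv)
        exact Finset.mem_coe.2 (Finset.mem_range.2 (hc a v
          (Finset.mem_erase.2 ⟨hv'.1, (Finset.mem_sdiff.1 (hQs j hv'.2)).1⟩)))
    rw [Fintype.sum_option, Fintype.sum_prod_type]
    simp only [hfib]
    rw [Finset.sum_coe_sort A fun a => ((Q j).erase a).card]
    have hAQ : (S none ∩ Q j).card = ∑ a ∈ A, if a ∈ Q j then 1 else 0 := by
      rw [← Finset.card_filter, Finset.filter_mem_eq_inter]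
    rw [hAQ, ← Finset.sum_add_distrib, Finset.sum_const_nat]
    intro a _
    split_ifs with ha
    · rw [add_comm, Finset.card_erase_add_one ha, hQc]
    · rw [Finset.erase_eq_of_notMem ha, hQc, zero_add]
  have hdiag : ∀ j, (S j ∩ Q j).card = 0 := by
    intro j
    rw [Finset.card_eq_zero, ← Finset.disjoint_iff_inter_eq_empty]
    exact Finset.disjoint_left.2 fun v hv hv' => (Finset.mem_sdiff.1 (hQs j hv')).2 hv
  have hcardI : Fintype.card (Option (A × Fin ω)) = A.card * ω + 1 := by simp
  -- `|A|ω + 1` entries, each at most 1 and the diagonal one 0, sum to `|A|ω`: the intersection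
  -- matrix is all ones minus the identity.
  have hentry : ∀ i j, ((S i ∩ Q j).card : ℚ) = 1 - if i = j then 1 else 0 := by
    intro i j
    by_cases hij : i = j
    · subst hij; simp [hdiag]
    · have hone : (S i ∩ Q j).card = 1 := by
        by_contra hne
        have hlt : (S i ∩ Q j).card < 1 := lt_of_le_of_ne (hle i j) hne
        have hlt' : ∑ k ∈ Finset.univ.erase j, (S k ∩ Q j).card
            < ∑ k ∈ Finset.univ.erase j, 1 :=
          Finset.sum_lt_sum (fun k _ => hle k j) ⟨i, by simp [hij], hlt⟩
        rw [Finset.sum_const, Finset.card_erase_of_mem (Finset.mem_univ _), Finset.card_univ,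
          hcardI] at hlt'
        have := Finset.add_sum_erase Finset.univ (fun k => (S k ∩ Q j).card) (Finset.mem_univ j)
        rw [hsum, hdiag] at this
        simp at hlt'
        omega
      simp [hone, hij]
  -- This matrix is nonsingular, so the incidence vectors of the `S i` are independent in `ℚ^s`;
  -- hence `|A|ω + 1 ≤ |s|`, against `hAω`.
  have hli : LinearIndependent ℚ
      (fun (i : Option (A × Fin ω)) (x : s) => if x.1 ∈ S i then (1 : ℚ) else 0) := by
    rw [Fintype.linearIndependent_iff]
    intro g hg
    have hpt : ∀ x ∈ s, ∑ i, g i * (if x ∈ S i then (1 : ℚ) else 0) = 0 := by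
      intro x hx
      simpa using congrFun hg ⟨x, hx⟩
    have hgj : ∀ j, g j = ∑ i, g i := by
      intro j
      have h0 : ∑ x ∈ Q j, ∑ i, g i * (if x ∈ S i then (1 : ℚ) else 0) = 0 :=
        Finset.sum_eq_zero fun x hx => hpt x (Finset.mem_sdiff.1 (hQs j hx)).1
      rw [Finset.sum_comm] at h0
      have h1 : ∀ i, ∑ x ∈ Q j, g i * (if x ∈ S i then (1 : ℚ) else 0)
          = g i * (1 - if i = j then 1 else 0) := by
        intro i
        rw [← hentry, ← Finset.mul_sum, Finset.sum_boole, Finset.filter_mem_eq_inter,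
          Finset.inter_comm]
      simp only [h1] at h0
      simp only [mul_sub, mul_one, Finset.sum_sub_distrib, mul_ite, mul_zero,
        Finset.sum_ite_eq', Finset.mem_univ, if_true] at h0
      linarith
    have hT : ∑ i, g i = 0 := by
      have h1 : ∑ i, g i = (A.card * ω + 1 : ℕ) * ∑ i, g i := by
        conv_lhs => rw [Finset.sum_congr rfl fun i _ => hgj i]
        rw [Finset.sum_const, Finset.card_univ, hcardI, nsmul_eq_mul]
      have h2 : ((A.card * ω : ℕ) : ℚ) ≠ 0 := by
        have := hs.card_pos
        exact_mod_cast (by omega : A.card * ω ≠ 0)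
      have h3 : ((A.card * ω : ℕ) : ℚ) * ∑ i, g i = 0 := by
        rw [Nat.cast_succ, add_mul, one_mul] at h1
        linarith
      exact (mul_eq_zero.1 h3).resolve_left h2
    intro j
    rw [hgj, hT]
  have := hli.fintype_card_le_finrank
  rw [hcardI, Module.finrank_fintype_fun_eq_card, Fintype.card_coe] at this
  omega

/-- Pigeonhole: take a largest colour class of an optimal colouring, together with a maximum clique.
-/
theorem IsPerfect.exists_card_le_mul {V : Type u} {G : SimpleGraph V} (hG : G.IsPerfect)
    (s : Finset V) : ∃ A ⊆ s, ∃ Q ⊆ s, G.IsIndepSet A ∧ G.IsClique Q ∧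
      s.card ≤ A.card * Q.card := by
  classical
  have hcol : (G.induce (s : Set V)).Colorable (G.induce (s : Set V)).cliqueNum :=
    chromaticNumber_le_iff_colorable.1 (hG s).le
  obtain ⟨C⟩ := hcol
  obtain ⟨Q, hQ, hQc⟩ := (G.induce (s : Set V)).exists_isNClique_cliqueNum
  rcases s.eq_empty_or_nonempty with rfl | ⟨v, hv⟩
  · exact ⟨∅, subset_rfl, ∅, subset_rfl, by simp⟩
  obtain ⟨i, -, hi⟩ := Finset.exists_max_image Finset.univ
    (fun i => (Finset.univ.filter fun x : (s : Set V) => C x = i).card) ⟨C ⟨v, hv⟩, by simp⟩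
  refine ⟨(Finset.univ.filter fun x : (s : Set V) => C x = i).map (.subtype _), ?_,
    Q.map (.subtype _), ?_, ?_, ?_, ?_⟩
  · intro x hx
    simp only [Finset.mem_map] at hx
    obtain ⟨x, -, rfl⟩ := hx
    exact x.2
  · intro x hx
    simp only [Finset.mem_map] at hx
    obtain ⟨x, -, rfl⟩ := hx
    exact x.2
  · intro x hx y hy _ hxy
    simp only [Finset.coe_map, Set.mem_image, Finset.coe_filter, Set.mem_ofPred_eq] at hx hy
    obtain ⟨x, hx, rfl⟩ := hx
    obtain ⟨y, hy, rfl⟩ := hy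
    exact C.valid (show (G.induce (s : Set V)).Adj x y from hxy) (hx.2.trans hy.2.symm)
  · intro x hx y hy hne
    simp only [Finset.coe_map, Set.mem_image] at hx hy
    obtain ⟨x, hx, rfl⟩ := hx
    obtain ⟨y, hy, rfl⟩ := hy
    exact hQ hx hy fun he => hne (he ▸ rfl)
  · rw [Finset.card_map, Finset.card_map, hQc, mul_comm]
    have h1 := Finset.card_eq_sum_card_fiberwise (f := C) (s := Finset.univ) (t := Finset.univ)
      (by simp)
    have h2 := Finset.sum_le_card_nsmul Finset.univ _ _ hi
    rw [← h1] at h2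
    simpa using h2

/-- The weak perfect graph theorem: the complement of a perfect graph `G` can be coloured by
as many colours as some independent set of `G` has vertices. -/
theorem IsPerfect.exists_compl_coloring {V : Type u} [Finite V] {G : SimpleGraph V}
    (hG : G.IsPerfect) : ∃ A : Finset V, G.IsIndepSet A ∧ ∃ c : V → ℕ, (∀ v, c v < A.card) ∧
      ∀ x y, Gᶜ.Adj x y → c x ≠ c y := by
  have := Fintype.ofFinite V
  obtain ⟨A, -, hA, c, hc, hadj⟩ := exists_coloring_of_card_le_mul Gᶜ (fun s => by
    obtain ⟨A, hAs, Q, hQs, hA, hQ, hc⟩ := hG.exists_card_le_mul s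
    exact ⟨Q, hQs, A, hAs, by simpa using hQ, by simpa using hA, by rwa [mul_comm]⟩) Finset.univ
  exact ⟨A, by simpa using hA, c, fun v => hc v (Finset.mem_univ v),
    fun x y => hadj x (Finset.mem_univ x) y (Finset.mem_univ y)⟩

/-! ### Cayley graphs of cyclic groups -/

theorem cyclicCayley_adj {n k : ℕ} {a b : ZMod n} : (cyclicCayley n k).Adj a b ↔
    a ≠ b ∧ ∃ j : ℕ, 1 ≤ j ∧ j ≤ k ∧ (a - b = j ∨ a - b = -j) := by
  rw [cyclicCayley, circulantGraph_adj]
  refine and_congr_right fun _ => ⟨?_, Or.inl⟩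
  rintro (h | ⟨j, h1, h2, h⟩)
  · exact h
  · refine ⟨j, h1, h2, ?_⟩
    rw [← neg_sub b a, neg_inj, neg_eq_iff_eq_neg]
    exact h.symm

theorem cyclicCayley_adj_of_val_div_eq {n k : ℕ} [NeZero n] {a b : ZMod n} (hab : a ≠ b)
    (h : a.val / (k + 1) = b.val / (k + 1)) : (cyclicCayley n k).Adj a b := by
  wlog hle : b.val ≤ a.val generalizing a b
  · exact (this hab.symm h.symm (le_of_not_ge hle)).symm
  refine cyclicCayley_adj.2 ⟨hab, a.val - b.val, ?_, ?_, Or.inl ?_⟩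
  · have : a.val ≠ b.val := fun h => hab (ZMod.val_injective n h)
    omega
  · have h1 := Nat.div_add_mod a.val (k + 1)
    have h2 := Nat.div_add_mod b.val (k + 1)
    have h3 : a.val % (k + 1) < k + 1 := Nat.mod_lt _ (Nat.succ_pos k)
    rw [h] at h1
    omega
  · rw [Nat.cast_sub hle, ZMod.natCast_zmod_val, ZMod.natCast_zmod_val]

/-- Points spaced `k+1` apart stay more than `k` apart across the wrap-around too, because `c(k+1) ≤
n`. -/
theorem compl_cyclicCayley_adj_add_mul {n k c : ℕ} (hn : c * (k + 1) ≤ n) (v : ZMod n) {i j : ℕ}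
    (hi : i < c) (hj : j < c) (hij : i ≠ j) :
    (cyclicCayley n k)ᶜ.Adj (v + (i * (k + 1) : ℕ)) (v + (j * (k + 1) : ℕ)) := by
  wlog hlt : j < i generalizing i j
  · exact (this hj hi hij.symm (by omega)).symm
  obtain ⟨m, rfl⟩ := Nat.exists_eq_add_of_lt hlt
  have hsub : v + ((j + m + 1) * (k + 1) : ℕ) - (v + (j * (k + 1) : ℕ))
      = (((m + 1) * (k + 1) : ℕ) : ZMod n) := by
    push_cast; ring
  have hbound : (m + 1) * (k + 1) + (k + 1) ≤ n := by
    refine le_trans ?_ hn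
    calc (m + 1) * (k + 1) + (k + 1) = (m + 2) * (k + 1) := by ring
      _ ≤ c * (k + 1) := Nat.mul_le_mul_right _ (by omega)
  have hlow : k + 1 ≤ (m + 1) * (k + 1) := Nat.le_mul_of_pos_left _ (by omega)
  have hminus : ∀ t ≤ k, (((m + 1) * (k + 1) : ℕ) : ZMod n) ≠ t := by
    intro t ht h
    rw [← sub_eq_zero, ← Nat.cast_sub (by omega), ZMod.natCast_eq_zero_iff] at h
    have := Nat.le_of_dvd (by omega) h
    omega
  have hplus : ∀ t ≤ k, (((m + 1) * (k + 1) : ℕ) : ZMod n) ≠ -t := by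
    intro t ht h
    rw [eq_neg_iff_add_eq_zero, ← Nat.cast_add, ZMod.natCast_eq_zero_iff] at h
    have := Nat.le_of_dvd (by omega) h
    omega
  refine ⟨fun h => ?_, fun h => ?_⟩
  · rw [← sub_eq_zero, hsub] at h
    exact hminus 0 (Nat.zero_le _) (by simpa using h)
  · obtain ⟨-, t, -, ht, h⟩ := cyclicCayley_adj.1 h
    rw [hsub] at h
    exact h.elim (hminus t ht) (hplus t ht)

/-- Blocks of `k+1` consecutive residues are cliques, and at most `c` blocks cover the cycle. -/
theorem InExpand.cyclicCayley_of_isIndepSet {U : Type u} [Finite U] {H : SimpleGraph U}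
    {n k c : ℕ} [NeZero n] {t : Finset U} (ht : H.IsIndepSet t) (hc : c ≤ t.card)
    (hn : n ≤ c * (k + 1)) : InExpand H (cyclicCayley n k) :=
  .of_coloring ht (fun x => x.val / (k + 1))
    (fun x => (Nat.div_lt_of_lt_mul ((ZMod.val_lt x).trans_le (by rwa [mul_comm]))).trans_le hc)
    fun _ _ hxy h => hxy.2 (cyclicCayley_adj_of_val_div_eq hxy.1 h)

theorem inExpand_cyclicCayley_mul {U : Type u} [Finite U] {H : SimpleGraph U} {n k c : ℕ}
    [NeZero n] (hn : n = c * (k + 1)) (h : relFracIndepNum (cyclicCayley n k) H ≤ 1) :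
    InExpand H (cyclicCayley n k) := by
  classical
  have hadj := fun {i j : ℕ} => compl_cyclicCayley_adj_add_mul (i := i) (j := j) hn.ge 0
  obtain ⟨t, ht, hc⟩ := exists_isIndepSet_card_le h
    (s := (Finset.range c).image fun i => (0 : ZMod n) + (i * (k + 1) : ℕ)) (by
      intro x hx y hy hne
      simp only [Finset.coe_image, Set.mem_image, Finset.coe_range, Set.mem_Iio] at hx hy
      obtain ⟨i, hi, rfl⟩ := hx
      obtain ⟨j, hj, rfl⟩ := hy
      exact (hadj hi hj fun he => hne (he ▸ rfl)).2)
  rw [Finset.card_image_of_injOn, Finset.card_range] at hc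
  · exact .cyclicCayley_of_isIndepSet ht hc hn.le
  · intro i hi j hj he
    by_contra hne
    exact (hadj (by simpa using hi) (by simpa using hj) hne).1 he

theorem inExpand_cyclicCayley_mul_add_one {U : Type u} [Finite U] {H : SimpleGraph U} {n k c : ℕ}
    [NeZero n] (hn : n = c * (k + 1) + 1) (h : relFracIndepNum (cyclicCayley n k) H ≤ 1) :
    InExpand H (cyclicCayley n k) := by
  classical
  by_cases hbig : ∃ t : Finset U, H.IsIndepSet t ∧ c + 1 ≤ t.card
  · obtain ⟨t, ht, hc⟩ := hbig
    exact .cyclicCayley_of_isIndepSet ht hc (by rw [hn, add_mul]; omega)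
  push Not at hbig
  obtain ⟨t, ht, hcard⟩ := exists_isIndepSet_strongProd h (cyclicCayley n k)ᶜ
    (s := Finset.univ.image fun x => (x, x)) (by
      intro x hx y hy hne hxy
      simp only [Finset.coe_image, Set.mem_image, Finset.coe_univ, Set.mem_univ, true_and] at hx hy
      obtain ⟨x, rfl⟩ := hx
      obtain ⟨y, rfl⟩ := hy
      rcases hxy with ⟨h1, h2⟩ | ⟨h1, h2⟩ | ⟨h1, h2⟩
      · exact h2.1 h1
      · exact h1.ne h2
      · exact h2.2 h1)
  rw [Finset.card_image_of_injective _ fun x y hxy => congrArg Prod.fst hxy, Finset.card_univ,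
    ZMod.card] at hcard
  have hne : ∀ p ∈ t, ∀ q ∈ t, p ≠ q → (p.2 = q.2 ∨ (cyclicCayley n k)ᶜ.Adj p.2 q.2) →
      p.1 ≠ q.1 ∧ ¬ H.Adj p.1 q.1 := by
    intro p hp q hq hpq h
    have := ht hp hq hpq
    refine ⟨fun he => ?_, fun he => this (h.elim (fun h => Or.inr (Or.inl ⟨he, h⟩))
      fun h => Or.inr (Or.inr ⟨he, h⟩))⟩
    exact h.elim (fun h => hpq (Prod.ext he h)) fun h => this (Or.inl ⟨he, h⟩)
  let w : ZMod n → ℕ := fun v => (t.filter fun p => p.2 = v).card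
  have hwsum : ∑ v, w v = t.card :=
    (Finset.card_eq_sum_card_fiberwise (by simp)).symm
  let F : ZMod n → ℕ := fun v => ∑ j ∈ Finset.range c, w (v + (j * (k + 1) : ℕ))
  have hadj := fun (v : ZMod n) {i j : ℕ} =>
    compl_cyclicCayley_adj_add_mul (i := i) (j := j) (hn ▸ Nat.le_succ _ : c * (k + 1) ≤ n) v
  -- Over a clique of `Gᶜ`, first coordinates of points of `t` are distinct and independent in `H`.
  have hFle : ∀ v, F v ≤ c := by
    intro v
    have hT : F v = ((Finset.range c).biUnion fun j =>
        t.filter fun p => p.2 = v + (j * (k + 1) : ℕ)).card := by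
      refine (Finset.card_biUnion fun i hi j hj hij => ?_).symm
      refine Finset.disjoint_left.2 fun p hp hp' => ?_
      exact (hadj v (Finset.mem_range.1 hi) (Finset.mem_range.1 hj) hij).1
        ((Finset.mem_filter.1 hp).2.symm.trans (Finset.mem_filter.1 hp').2)
    have hT' : ∀ p ∈ (Finset.range c).biUnion fun j =>
        t.filter fun p => p.2 = v + (j * (k + 1) : ℕ),
        ∀ q ∈ (Finset.range c).biUnion fun j =>
        t.filter fun p => p.2 = v + (j * (k + 1) : ℕ), p ≠ q → p.1 ≠ q.1 ∧ ¬ H.Adj p.1 q.1 := by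
      intro p hp q hq hpq
      simp only [Finset.mem_biUnion, Finset.mem_range, Finset.mem_filter] at hp hq
      obtain ⟨i, hi, hp, hpi⟩ := hp
      obtain ⟨j, hj, hq, hqj⟩ := hq
      refine hne p hp q hq hpq ?_
      rw [hpi, hqj]
      by_cases hij : i = j
      · exact Or.inl (hij ▸ rfl)
      · exact Or.inr (hadj v hi hj hij)
    rw [hT, ← Finset.card_image_of_injOn (f := Prod.fst)]
    · refine Nat.le_of_lt_succ (hbig _ ?_)
      intro x hx y hy hxy
      obtain ⟨p, hp, rfl⟩ := Finset.mem_image.1 (Finset.mem_coe.1 hx)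
      obtain ⟨q, hq, rfl⟩ := Finset.mem_image.1 (Finset.mem_coe.1 hy)
      exact (hT' p hp q hq fun he => hxy (he ▸ rfl)).2
    · intro p hp q hq he
      by_contra hpq
      exact (hT' p hp q hq hpq).1 he
  have hFsum : ∑ v, F v = c * t.card := by
    rw [Finset.sum_comm, Finset.sum_const_nat, Finset.card_range]
    intro j _
    rw [← hwsum]
    exact Equiv.sum_comp (Equiv.addRight ((j * (k + 1) : ℕ) : ZMod n)) w
  -- The average of `F` is `c|t|/n ≥ c`, so every bound `F v ≤ c` is tight.
  have hF : ∀ v, F v = c := by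
    have h1 : ∑ v, F v = ∑ _v : ZMod n, c := by
      refine le_antisymm (Finset.sum_le_sum fun v _ => hFle v) ?_
      rw [hFsum, Finset.sum_const, Finset.card_univ, ZMod.card, smul_eq_mul, mul_comm]
      exact Nat.mul_le_mul_left _ hcard
    exact fun v => (Finset.sum_eq_sum_iff_of_le fun v _ => hFle v).1 h1 v (Finset.mem_univ v)
  have hshift : ∀ v, w (v + 1) = w v := by
    intro v
    -- Shifting the progression by one step `k+1` drops `v + 1` and gains `v + 1 + c(k+1)`, which is
    -- `v` modulo `n`.
    have h1 : F (v + 1) + w (v + 1 + (c * (k + 1) : ℕ)) = F (v + 1 + (k + 1 : ℕ)) + w (v + 1) := by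
      simp only [F]
      rw [← Finset.sum_range_succ (fun j => w (v + 1 + (j * (k + 1) : ℕ))), Finset.sum_range_succ']
      congr 1
      · refine Finset.sum_congr rfl fun j _ => congrArg w ?_
        push_cast; ring
      · simp
    have h2 : v + 1 + (c * (k + 1) : ℕ) = v := by
      have h3 : ((c * (k + 1) + 1 : ℕ) : ZMod n) = 0 := by rw [← hn]; simp
      rw [add_assoc, add_comm 1, ← Nat.cast_succ, Nat.succ_eq_add_one, h3, add_zero]
    rw [h2, hF, hF] at h1
    omega
  have hconst : ∀ v, w v = w 0 := by
    have hnat : ∀ m : ℕ, w (m : ZMod n) = w 0 := by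
      intro m
      induction m with
      | zero => simp
      | succ m ih => rw [Nat.cast_succ, hshift, ih]
    intro v
    rw [← ZMod.natCast_zmod_val v]
    exact hnat _
  have hpos : ∀ v, 0 < w v := by
    intro v
    rw [hconst, Nat.pos_iff_ne_zero]
    intro h0
    have : ∑ v, w v = 0 := Finset.sum_eq_zero fun v _ => (hconst v).trans h0
    have := NeZero.pos n
    omega
  choose f hf using fun v => Finset.card_pos.1 (hpos v)
  simp only [Finset.mem_filter] at hf
  refine InExpand.of_compl_hom ⟨fun v => (f v).1, fun {x y} hxy => ?_⟩
  refine hne _ (hf x).1 _ (hf y).1 (fun he => hxy.1 ?_) (Or.inr ?_)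
  · rw [← (hf x).2, ← (hf y).2, he]
  · rwa [(hf x).2, (hf y).2]

end SimpleGraph

theorem theorem7 {U : Type*} [Finite U] (H : SimpleGraph U) :
    (∀ (n k c : ℕ), 1 ≤ n → (n = c * (k + 1) ∨ n = c * (k + 1) + 1) →
      SimpleGraph.relFracIndepNum (SimpleGraph.cyclicCayley n k) H ≤ 1 →
      SimpleGraph.InExpand H (SimpleGraph.cyclicCayley n k)) ∧
    (∀ {V : Type*} [Finite V] (G : SimpleGraph V), G.IsPerfect →
      SimpleGraph.relFracIndepNum G H ≤ 1 → SimpleGraph.InExpand H G) := by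
  refine ⟨fun n k c hn hnc h => ?_, fun G hG h => ?_⟩
  · have : NeZero n := ⟨by omega⟩
    exact hnc.elim (SimpleGraph.inExpand_cyclicCayley_mul · h)
      (SimpleGraph.inExpand_cyclicCayley_mul_add_one · h)
  · obtain ⟨A, hA, c, hc, hadj⟩ := hG.exists_compl_coloring
    obtain ⟨t, ht, hcard⟩ := SimpleGraph.exists_isIndepSet_card_le h hA
    exact .of_coloring ht c (fun v => (hc v).trans_le hcard) hadj
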